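/- For $a,b,c>0$ and $x\in\mathbb{R}$ let $E_{a,b}^{c}(x)=\frac{1}{\Gamma(c)}\sum_{j\ge0}\frac{\Gamma(j+c)\,x^{j}}{j!\,\Gamma(ja+b)}$ be the three-parameter Mittag-Leffler function and $E_{a,b}=E_{a,b}^{1}$. For $0<\beta\le1$ let $\frac{d^{\beta}}{dt^{\beta}}$ be the Caputo derivative, $\frac{d^{\beta}}{dt^{\beta}}f(t)=\frac{1}{\Gamma(1-\beta)}\int_0^t(t-s)^{-\beta}f'(s)\,ds$ if $\beta<1$ and $f'(t)$ if $\beta=1$. Let $\alpha>0$, $\theta>0$, $0<\beta\le1$. A fractional Bell-Touchard process is a process $\{\mathcal{M}_\beta(t)\}_{t\ge0}$ with values in $\{0,1,2,\dots\}$ whose state probabilities $q_\beta(n,t)=\Pr\{\mathcal{M}_\beta(t)=n\}$ are, as functions of $t$, absolutely continuous on $[0,T]$ for every $T>0$, and satisfy, for almost every $t>0$, $$\frac{d^{\beta}}{dt^{\beta}}q_\beta(0,t)=-\alpha(e^{\theta}-1)q_\beta(0,t),$$ $$\frac{d^{\beta}}{dt^{\beta}}q_\beta(n,t)=-\alpha(e^{\theta}-1)q_\beta(n,t)+\alpha\sum_{j=1}^{n}\frac{\theta^{j}}{j!}q_\beta(n-j,t),\quad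 n\ge1,$$ with $q_\beta(0,0)=1$ and $q_\beta(n,0)=0$ for $n\ge1$. **Theorem.** Let $\{\mathcal{M}_\beta(t)\}_{t\ge0}$ be a fractional Bell-Touchard process with parameters $\alpha,\theta,\beta$. Then for every $t\ge0$ $$q_\beta(0,t)=E_{\beta,1}\left(-\alpha(e^{\theta}-1)t^{\beta}\right),$$ and for every $n\ge1$ $$q_\beta(n,t)=\sum_{(x_1,\dots,x_n)\in\Omega_n}\left(\prod_{j=1}^{n}\frac{(\alpha\theta^{j}/j!)^{x_j}}{x_j!}\right)z_n!\,t^{z_n\beta}\,E_{\beta,z_n\beta+1}^{z_n+1}\left(-\alpha(e^{\theta}-1)t^{\beta}\right),$$ where $\Omega_n=\{(x_1,\dots,x_n)\in\{0,1,2,\dots\}^n:\sum_{j=1}^{n}jx_j=n\}$ and $z_n=x_1+\dots+x_n$. -/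

import Mathlib

open MeasureTheory
open scoped NNReal Nat

/-- The three-parameter Mittag-Leffler function
`E_{a,b}^c(x) = (1 / Γ(c)) ∑_{j ≥ 0} Γ(j + c) x^j / (j! Γ(j a + b))`. -/
noncomputable def mittagLeffler3 (a b c x : ℝ) : ℝ :=
  (1 / Real.Gamma c) *
    ∑' j : ℕ, Real.Gamma (j + c) * x ^ j / ((j ! : ℝ) * Real.Gamma (j * a + b))

/-- The two-parameter Mittag-Leffler function `E_{a,b}(x)`, the case `c = 1`. -/
noncomputable def mittagLeffler2 (a b x : ℝ) : ℝ := mittagLeffler3 a b 1 x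

/-- The Caputo fractional derivative of order `β` (for `0 < β ≤ 1`) of `f` at `t > 0`. -/
noncomputable def caputoDeriv (β : ℝ) (f : ℝ → ℝ) (t : ℝ) : ℝ :=
  if β = 1 then deriv f t
  else (1 / Real.Gamma (1 - β)) * ∫ s in (0 : ℝ)..t, (t - s) ^ (-β) * deriv f s

/-- The state probability `Pr{M(t) = n}`, as a function of a real variable `t`; only the values
at `t ≥ 0` matter. -/
noncomputable def stateProb {Ω : Type*} [MeasurableSpace Ω] (P : Measure Ω)
    (M : ℝ≥0 → Ω → ℕ) (n : ℕ) (t : ℝ) : ℝ :=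
  P.real {ω | M t.toNNReal ω = n}

/-- `M` is a fractional Bell-Touchard process with parameters `α`, `θ` and order `β`:
a process with values in `ℕ` whose state probabilities solve the Caputo system of the process
with initial state `0`. The state probabilities are locally absolutely continuous on `[0, ∞)`,
the class of functions on which the Caputo derivative is defined (almost everywhere). -/
structure IsFractionalBellTouchard {Ω : Type*} [MeasurableSpace Ω] (P : Measure Ω)
    (α θ β : ℝ) (M : ℝ≥0 → Ω → ℕ) : Prop where
  measurable : ∀ t, Measurable (M t)
  absolutelyContinuous : ∀ n : ℕ, ∀ T : ℝ, 0 < T →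
    AbsolutelyContinuousOnInterval (stateProb P M n) 0 T
  initial_zero : stateProb P M 0 0 = 1
  initial_pos : ∀ n : ℕ, 1 ≤ n → stateProb P M n 0 = 0
  system_zero : ∀ᵐ t : ℝ, 0 < t →
    caputoDeriv β (stateProb P M 0) t = -α * (Real.exp θ - 1) * stateProb P M 0 t
  system_pos : ∀ n : ℕ, 1 ≤ n → ∀ᵐ t : ℝ, 0 < t →
    caputoDeriv β (stateProb P M n) t =
      -α * (Real.exp θ - 1) * stateProb P M n t +
        α * ∑ j ∈ Finset.Icc 1 n, θ ^ j / (j ! : ℝ) * stateProb P M (n - j) t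

/-- The set `Ω_n` of all `(x_1, …, x_n)` in `ℕ^n` with `∑ j x_j = n`; the entry `x_j` is
`x i` with `i = j - 1`. The bound `x_j ≤ n` only serves to make a finite set and follows from the
equation, see `mem_partitionTuples`. -/
def partitionTuples (n : ℕ) : Finset (Fin n → ℕ) :=
  (Fintype.piFinset fun _ : Fin n => Finset.range (n + 1)).filter
    fun x => ∑ i : Fin n, ((i : ℕ) + 1) * x i = n

theorem mem_partitionTuples {n : ℕ} {x : Fin n → ℕ} :
    x ∈ partitionTuples n ↔ ∑ i : Fin n, ((i : ℕ) + 1) * x i = n := by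
  unfold partitionTuples
  rw [Finset.mem_filter, Fintype.mem_piFinset]
  refine ⟨fun h => h.2, fun h => ⟨fun i => ?_, h⟩⟩
  have h1 : ((i : ℕ) + 1) * x i ≤ ∑ i : Fin n, ((i : ℕ) + 1) * x i :=
    Finset.single_le_sum (f := fun i : Fin n => ((i : ℕ) + 1) * x i)
      (fun _ _ => Nat.zero_le _) (Finset.mem_univ i)
  rw [h] at h1
  rw [Finset.mem_range]
  nlinarith

/-! Integrating the Caputo system with the Riemann-Liouville integral J of order β gives Volterra
equations q_n = δ_{n,0} + J (A * q)_n, where the power series A has constant term l = -α(e^θ - 1)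
and coefficients αθ^j/j! for j ≥ 1, and * is convolution in n (`eq_add_integral_of_caputoDeriv_eq`).
Since J sends t^(mβ)/Γ(mβ+1) to the next such power, iterating N times produces the partial sum over
m < N of [X^n]A^m t^(mβ)/Γ(mβ+1). As 0 ≤ q_n ≤ 1 and the absolute coefficient sums of A are at most
some K, the remainder is at most K^N t^(Nβ)/Γ(Nβ+1), which tends to 0
(`abs_sub_sum_coeff_pow_mul_rlPow_le`, `summable_pow_mul_rlPow`).

The rest is algebra. Splitting off l by the binomial theorem and expanding by the multinomial
theorem writes [X^n]A^m as a sum over Ω_n (`coeff_mk_pow_eq_sum_tupleWeight`); for fixed z = z_n the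
sum over m is a three-parameter Mittag-Leffler function (`hasSum_choose_mul_rlPow`). -/

/-! ### Inverting the Caputo derivative -/

/-- The Beta integral on `[0, t]`. -/
theorem integral_sub_rpow_mul_rpow {a b t : ℝ} (ha : 0 < a) (hb : 0 < b) (ht : 0 < t) :
    ∫ s in (0 : ℝ)..t, (t - s) ^ (a - 1) * s ^ (b - 1) =
      Real.Gamma a * Real.Gamma b / Real.Gamma (a + b) * t ^ (a + b - 1) := by
  have h := Complex.betaIntegral_scaled (b : ℂ) (a : ℂ) ht
  rw [Complex.betaIntegral_eq_Gamma_mul_div _ _ (by simpa using hb) (by simpa using ha)] at h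
  have h2 : ∫ x in (0 : ℝ)..t, (x : ℂ) ^ ((b : ℂ) - 1) * ((t : ℂ) - x) ^ ((a : ℂ) - 1) =
      ∫ x in (0 : ℝ)..t, (((t - x) ^ (a - 1) * x ^ (b - 1) : ℝ) : ℂ) := by
    refine intervalIntegral.integral_congr fun x hx => ?_
    rw [Set.uIcc_of_le ht.le] at hx
    rw [Complex.ofReal_mul, Complex.ofReal_cpow (by linarith [hx.2]), Complex.ofReal_cpow hx.1]
    push_cast
    ring
  rw [h2, intervalIntegral.integral_ofReal] at h
  have h3 : (t : ℂ) ^ ((b : ℂ) + a - 1) *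
      (Complex.Gamma b * Complex.Gamma a / Complex.Gamma (b + a)) =
      ((Real.Gamma a * Real.Gamma b / Real.Gamma (a + b) * t ^ (a + b - 1) : ℝ) : ℂ) := by
    push_cast
    rw [Complex.ofReal_cpow ht.le, ← Complex.Gamma_ofReal, ← Complex.Gamma_ofReal,
      ← Complex.Gamma_ofReal]
    push_cast
    rw [add_comm (b : ℂ) a]
    ring
  rw [h3] at h
  exact_mod_cast h

theorem intervalIntegrable_sub_rpow {a t : ℝ} (ha : 0 < a) :
    IntervalIntegrable (fun s => (t - s) ^ (a - 1)) volume 0 t := by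
  have h := (intervalIntegral.intervalIntegrable_rpow' (a := 0) (b := t) (r := a - 1)
    (by linarith)).comp_sub_left t
  simp only [sub_zero, sub_self] at h
  exact h.symm

/-- The kernel `x ↦ x ^ (a - 1)` of the Riemann-Liouville integral, extended by zero. -/
noncomputable def rlKernel (a x : ℝ) : ℝ := if 0 < x then x ^ (a - 1) else 0

theorem rlKernel_nonneg (a x : ℝ) : 0 ≤ rlKernel a x := by
  unfold rlKernel
  split_ifs with h
  · exact Real.rpow_nonneg h.le _
  · exact le_rfl

theorem measurable_rlKernel (a : ℝ) : Measurable (rlKernel a) :=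
  Measurable.ite measurableSet_Ioi (by fun_prop) measurable_const

theorem integral_rlKernel_mul {a b t u : ℝ} (ha : 0 < a) (hb : 0 < b) :
    ∫ s, rlKernel a (t - s) * rlKernel b (s - u) =
      Real.Gamma a * Real.Gamma b / Real.Gamma (a + b) * rlKernel (a + b) (t - u) := by
  by_cases htu : u < t
  · have h1 : (fun s => rlKernel a (t - s) * rlKernel b (s - u)) =
        (Set.Ioo u t).indicator fun s => (t - s) ^ (a - 1) * (s - u) ^ (b - 1) := by
      funext s
      by_cases hs : s ∈ Set.Ioo u t
      · rw [Set.indicator_of_mem hs, rlKernel, rlKernel, if_pos (by linarith [hs.2]),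
          if_pos (by linarith [hs.1])]
      · rw [Set.indicator_of_notMem hs]
        by_cases h : s < t
        · have : ¬ 0 < s - u := fun h' => hs ⟨by linarith, h⟩
          simp [rlKernel, this]
        · have : ¬ 0 < t - s := fun h' => h (by linarith)
          simp [rlKernel, this]
    rw [h1, integral_indicator measurableSet_Ioo, ← integral_Ioc_eq_integral_Ioo,
      ← intervalIntegral.integral_of_le htu.le]
    have h2 := intervalIntegral.integral_comp_sub_right (a := u) (b := t)
      (fun s => (t - u - s) ^ (a - 1) * s ^ (b - 1)) u
    simp only [sub_self, sub_sub_sub_cancel_right] at h2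
    rw [h2, integral_sub_rpow_mul_rpow ha hb (sub_pos.2 htu), rlKernel, if_pos (sub_pos.2 htu)]
  · have h1 : (fun s => rlKernel a (t - s) * rlKernel b (s - u)) = fun _ => 0 := by
      funext s
      by_cases h : s < t
      · have : ¬ 0 < s - u := by linarith
        simp [rlKernel, this]
      · have : ¬ 0 < t - s := by linarith
        simp [rlKernel, this]
    have : ¬ 0 < t - u := by linarith
    rw [h1, rlKernel, if_neg this]
    simp

theorem integrable_rlKernel_mul {a b t u : ℝ} (ha : 0 < a) (hb : 0 < b) :
    Integrable fun s => rlKernel a (t - s) * rlKernel b (s - u) := by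
  by_cases htu : u < t
  -- A non-integrable function has integral 0 by convention, so the positive Beta value proves
  -- integrability.
  · refine Integrable.of_integral_ne_zero ?_
    rw [integral_rlKernel_mul ha hb, rlKernel, if_pos (sub_pos.2 htu)]
    have := Real.Gamma_pos_of_pos ha
    have := Real.Gamma_pos_of_pos hb
    have := Real.Gamma_pos_of_pos (add_pos ha hb)
    have := Real.rpow_pos_of_pos (sub_pos.2 htu) (a + b - 1)
    positivity
  · have h1 : (fun s => rlKernel a (t - s) * rlKernel b (s - u)) = fun _ => 0 := by
      funext s
      by_cases h : s < t
      · have : ¬ 0 < s - u := by linarith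
        simp [rlKernel, this]
      · have : ¬ 0 < t - s := by linarith
        simp [rlKernel, this]
    rw [h1]
    exact integrable_zero _ _ _

/-- Composition of the Riemann-Liouville integrals of orders `a` and `1 - a`. -/
theorem integral_sub_rpow_mul_integral_sub_rpow {a t : ℝ} (ha : 0 < a) (ha1 : a < 1) (ht : 0 ≤ t)
    {w : ℝ → ℝ} (hw : IntervalIntegrable w volume 0 t) :
    ∫ s in (0 : ℝ)..t, (t - s) ^ (a - 1) * ∫ u in (0 : ℝ)..s, (s - u) ^ (-a) * w u =
      Real.Gamma a * Real.Gamma (1 - a) * ∫ u in (0 : ℝ)..t, w u := by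
  have hb : 0 < 1 - a := by linarith
  set v : ℝ → ℝ := (Set.Ioo 0 t).indicator w with hv_def
  have hv : Integrable v := by
    rw [hv_def, integrable_indicator_iff measurableSet_Ioo]
    rw [intervalIntegrable_iff_integrableOn_Ioo_of_le ht] at hw
    exact hw
  set F : ℝ → ℝ → ℝ := fun s u => rlKernel a (t - s) * rlKernel (1 - a) (s - u) * v u with hF
  have hmeas : AEStronglyMeasurable (Function.uncurry F) (volume.prod volume) := by
    refine AEStronglyMeasurable.mul (Measurable.aestronglyMeasurable ?_) hv.1.comp_snd
    exact ((measurable_rlKernel a).comp (measurable_const.sub measurable_fst)).mul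
      ((measurable_rlKernel (1 - a)).comp (measurable_fst.sub measurable_snd))
  have hint : Integrable (Function.uncurry F) (volume.prod volume) := by
    rw [integrable_prod_iff' hmeas]
    refine ⟨Filter.Eventually.of_forall fun u => ?_, ?_⟩
    · exact (integrable_rlKernel_mul (t := t) (u := u) ha hb).mul_const (v u)
    -- The orders add up to 1 and `rlKernel 1` equals 1 on positive arguments, so integrating in s
    -- first leaves only a constant times ‖v u‖.
    · have : (fun u => ∫ s, ‖Function.uncurry F (s, u)‖) =
          fun u => (Real.Gamma a * Real.Gamma (1 - a)) * ‖v u‖ := by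
        funext u
        have h1 : (fun s => ‖Function.uncurry F (s, u)‖) =
            fun s => rlKernel a (t - s) * rlKernel (1 - a) (s - u) * ‖v u‖ := by
          funext s
          simp only [Function.uncurry, hF, norm_mul, Real.norm_of_nonneg (rlKernel_nonneg _ _)]
        rw [h1, integral_mul_const, integral_rlKernel_mul ha hb]
        by_cases hu : u ∈ Set.Ioo 0 t
        · simp [rlKernel, hu.2]
        · simp [hv_def, Set.indicator_of_notMem hu]
      rw [this]
      exact hv.norm.const_mul _
  have hswap := integral_integral_swap hint
  have hR : ∫ u, ∫ s, F s u = Real.Gamma a * Real.Gamma (1 - a) * ∫ u in (0 : ℝ)..t, w u := by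
    rw [intervalIntegral.integral_of_le ht, integral_Ioc_eq_integral_Ioo,
      ← integral_indicator measurableSet_Ioo, ← integral_const_mul]
    refine integral_congr_ae (Filter.Eventually.of_forall fun u => ?_)
    simp only [hF]
    rw [integral_mul_const, integral_rlKernel_mul ha hb]
    by_cases hu : u ∈ Set.Ioo 0 t
    · simp [rlKernel, hu.2, hv_def]
    · simp [hv_def, Set.indicator_of_notMem hu]
  have hL : ∫ s, ∫ u, F s u =
      ∫ s in (0 : ℝ)..t, (t - s) ^ (a - 1) * ∫ u in (0 : ℝ)..s, (s - u) ^ (-a) * w u := by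
    rw [intervalIntegral.integral_of_le ht, integral_Ioc_eq_integral_Ioo,
      ← integral_indicator measurableSet_Ioo]
    refine integral_congr_ae (Filter.Eventually.of_forall fun s => ?_)
    simp only [hF, mul_assoc]
    rw [integral_const_mul]
    by_cases hs : s ∈ Set.Ioo 0 t
    · rw [Set.indicator_of_mem hs, rlKernel, if_pos (by linarith [hs.2])]
      congr 1
      rw [intervalIntegral.integral_of_le hs.1.le, integral_Ioc_eq_integral_Ioo,
        ← integral_indicator measurableSet_Ioo]
      congr 1
      funext u
      by_cases hu : u ∈ Set.Ioo 0 s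
      · have hu' : u ∈ Set.Ioo 0 t := ⟨hu.1, hu.2.trans hs.2⟩
        rw [Set.indicator_of_mem hu, hv_def, Set.indicator_of_mem hu', rlKernel,
          if_pos (by linarith [hu.2])]
        congr 2
        ring
      · rw [Set.indicator_of_notMem hu]
        by_cases h : u < s
        · have : u ∉ Set.Ioo 0 t := fun h' => hu ⟨h'.1, h⟩
          rw [hv_def, Set.indicator_of_notMem this, mul_zero]
        · rw [rlKernel, if_neg (by linarith), zero_mul]
    · rw [Set.indicator_of_notMem hs]
      by_cases h : 0 < s
      · have : ¬ s < t := fun h' => hs ⟨h, h'⟩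
        rw [rlKernel, if_neg (by linarith), zero_mul]
      · have : (fun u => rlKernel (1 - a) (s - u) * v u) = fun _ => 0 := by
          funext u
          by_cases hu : 0 < u
          · rw [rlKernel, if_neg (by linarith), zero_mul]
          · rw [hv_def, Set.indicator_of_notMem (fun h' => hu h'.1), mul_zero]
        rw [this]
        simp
  rw [← hL, hswap, hR]

/-- The Caputo equation with right-hand side `g`, integrated. -/
theorem eq_add_integral_of_caputoDeriv_eq {β : ℝ} (hβ : 0 < β) (hβ1 : β ≤ 1) {f g : ℝ → ℝ}
    {t : ℝ} (ht : 0 ≤ t) (hf : AbsolutelyContinuousOnInterval f 0 t)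
    (hfg : ∀ᵐ s : ℝ, 0 < s → caputoDeriv β f s = g s) :
    f t = f 0 + 1 / Real.Gamma β * ∫ s in (0 : ℝ)..t, (t - s) ^ (β - 1) * g s := by
  have hftc := hf.integral_deriv_eq_sub
  have hcongr : ∫ s in (0 : ℝ)..t, (t - s) ^ (β - 1) * g s =
      ∫ s in (0 : ℝ)..t, (t - s) ^ (β - 1) * caputoDeriv β f s := by
    refine intervalIntegral.integral_congr_ae ?_
    filter_upwards [hfg] with s hs hmem
    rw [Set.uIoc_of_le ht] at hmem
    rw [hs hmem.1]
  rw [hcongr]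
  rcases hβ1.eq_or_lt with rfl | hlt
  · simp only [caputoDeriv, sub_self, Real.rpow_zero, one_mul, if_true, Real.Gamma_one]
    rw [hftc]
    ring
  · have h1 : (fun s => (t - s) ^ (β - 1) * caputoDeriv β f s) = fun s =>
        1 / Real.Gamma (1 - β) *
          ((t - s) ^ (β - 1) * ∫ u in (0 : ℝ)..s, (s - u) ^ (-β) * deriv f u) := by
      funext s
      rw [caputoDeriv, if_neg hlt.ne]
      ring
    rw [h1, intervalIntegral.integral_const_mul,
      integral_sub_rpow_mul_integral_sub_rpow hβ hlt ht hf.intervalIntegrable_deriv, hftc]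
    have := (Real.Gamma_pos_of_pos hβ).ne'
    have := (Real.Gamma_pos_of_pos (sub_pos.2 hlt)).ne'
    field_simp
    ring

/-! ### Growth of Γ and normalized powers -/

/-- Keep only x > R in the Gamma integral, where x^(s-1) ≥ R^(s-1). As R is free, Γ(mβ+1) outgrows
every geometric sequence in m. -/
theorem rpow_mul_exp_neg_le_Gamma {R s : ℝ} (hR : 0 < R) (hs : 1 ≤ s) :
    R ^ (s - 1) * Real.exp (-R) ≤ Real.Gamma s := by
  have hconv := Real.GammaIntegral_convergent (s := s) (by linarith)
  have hsub : Set.Ioi R ⊆ Set.Ioi (0 : ℝ) := Set.Ioi_subset_Ioi hR.le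
  rw [Real.Gamma_eq_integral (by linarith)]
  calc R ^ (s - 1) * Real.exp (-R) = ∫ x in Set.Ioi R, Real.exp (-x) * R ^ (s - 1) := by
        rw [integral_mul_const, integral_exp_neg_Ioi, mul_comm]
    _ ≤ ∫ x in Set.Ioi R, Real.exp (-x) * x ^ (s - 1) := by
        refine setIntegral_mono_on ?_ (hconv.mono_set hsub) measurableSet_Ioi fun x hx => ?_
        · exact (integrableOn_exp_neg_Ioi R).mul_const _
        · have hx' : R < x := hx
          gcongr
    _ ≤ ∫ x in Set.Ioi (0 : ℝ), Real.exp (-x) * x ^ (s - 1) := by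
        refine setIntegral_mono_set hconv ?_ hsub.eventuallyLE
        filter_upwards [ae_restrict_mem measurableSet_Ioi] with x hx
        have hx' : (0 : ℝ) < x := hx
        simp only [Pi.zero_apply]
        positivity

/-- The normalized power `t ^ (m β) / Γ(m β + 1)`. -/
noncomputable def rlPow (β : ℝ) (m : ℕ) (t : ℝ) : ℝ := t ^ (m * β) / Real.Gamma (m * β + 1)

theorem rlPow_nonneg {β t : ℝ} (hβ : 0 < β) (ht : 0 ≤ t) (m : ℕ) : 0 ≤ rlPow β m t :=
  div_nonneg (Real.rpow_nonneg ht _) (Real.Gamma_pos_of_pos (by positivity)).le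

theorem rlPow_zero (β t : ℝ) : rlPow β 0 t = 1 := by simp [rlPow]

theorem continuousOn_rlPow {β : ℝ} (hβ : 0 < β) (m : ℕ) (s : Set ℝ) :
    ContinuousOn (rlPow β m) s :=
  ((Real.continuous_rpow_const (by positivity)).div_const _).continuousOn

theorem summable_pow_mul_rlPow {β t K : ℝ} (hβ : 0 < β) (ht : 0 ≤ t) (hK : 0 ≤ K) :
    Summable fun m : ℕ => K ^ m * rlPow β m t := by
  -- With R^β = 2Kt^β + 1 the m-th term is at most e^R 2^(-m); the summand 1 keeps R positive when
  -- Kt^β = 0.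
  set R : ℝ := (2 * (K * t ^ β) + 1) ^ β⁻¹ with hRdef
  have hx : 0 ≤ K * t ^ β := by positivity
  have hR : 0 < R := by positivity
  have hRβ : R ^ β = 2 * (K * t ^ β) + 1 := by
    rw [hRdef, Real.rpow_inv_rpow (by positivity) hβ.ne']
  have hgeo : Summable fun m : ℕ => Real.exp R * (1 / 2 : ℝ) ^ m :=
    (summable_geometric_of_lt_one (by norm_num) (by norm_num)).mul_left _
  refine hgeo.of_nonneg_of_le (fun m => mul_nonneg (by positivity) (rlPow_nonneg hβ ht m))
    fun m => ?_
  have hG := rpow_mul_exp_neg_le_Gamma (s := m * β + 1) hR (by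
    have : 0 ≤ m * β := by positivity
    linarith)
  have hGpos : 0 < Real.Gamma (m * β + 1) := Real.Gamma_pos_of_pos (by positivity)
  rw [add_sub_cancel_right, mul_comm (m : ℝ) β, Real.rpow_mul hR.le, Real.rpow_natCast, hRβ] at hG
  rw [rlPow, ← mul_div_assoc, div_le_iff₀ hGpos, mul_comm (m : ℝ) β, Real.rpow_mul ht,
    Real.rpow_natCast, ← mul_pow]
  calc (K * t ^ β) ^ m ≤ (1 / 2 * (2 * (K * t ^ β) + 1)) ^ m := by
        refine pow_le_pow_left₀ hx ?_ m
        linarith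
    _ = Real.exp R * (1 / 2) ^ m * ((2 * (K * t ^ β) + 1) ^ m * Real.exp (-R)) := by
        rw [mul_pow, Real.exp_neg]
        field_simp
    _ ≤ _ := by gcongr

/-! ### The Riemann-Liouville integral as an operator -/

/-- The Riemann-Liouville integral of order `β`. -/
noncomputable def rlIntegral (β : ℝ) (g : ℝ → ℝ) (t : ℝ) : ℝ :=
  1 / Real.Gamma β * ∫ s in (0 : ℝ)..t, (t - s) ^ (β - 1) * g s

theorem rlIntegral_rlPow {β t : ℝ} (hβ : 0 < β) (ht : 0 ≤ t) (m : ℕ) :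
    rlIntegral β (rlPow β m) t = rlPow β (m + 1) t := by
  have hm : 0 < m * β + 1 := by positivity
  have hm' : 0 < ((m + 1 : ℕ) : ℝ) * β + 1 := by positivity
  rcases ht.eq_or_lt with rfl | ht
  · have : ((m + 1 : ℕ) : ℝ) * β ≠ 0 := by positivity
    simp only [rlIntegral, rlPow, intervalIntegral.integral_same, mul_zero,
      Real.zero_rpow this, zero_div]
  · have h := integral_sub_rpow_mul_rpow hβ hm ht
    have h1 : (fun s => (t - s) ^ (β - 1) * rlPow β m s) = fun s =>
        (1 / Real.Gamma (m * β + 1)) * ((t - s) ^ (β - 1) * s ^ (m * β + 1 - 1)) := by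
      funext s
      rw [rlPow, add_sub_cancel_right]
      ring
    have h2 : β + (m * β + 1) = ((m + 1 : ℕ) : ℝ) * β + 1 := by push_cast; ring
    rw [rlIntegral, h1, intervalIntegral.integral_const_mul, h, h2, rlPow, add_sub_cancel_right]
    have := (Real.Gamma_pos_of_pos hβ).ne'
    have := (Real.Gamma_pos_of_pos hm).ne'
    have := (Real.Gamma_pos_of_pos hm').ne'
    field_simp

theorem intervalIntegrable_sub_rpow_mul {β t : ℝ} (hβ : 0 < β) {g : ℝ → ℝ} (ht : 0 ≤ t)
    (hg : ContinuousOn g (Set.Ici 0)) :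
    IntervalIntegrable (fun s => (t - s) ^ (β - 1) * g s) volume 0 t := by
  refine (intervalIntegrable_sub_rpow hβ).mul_continuousOn (hg.mono ?_)
  rw [Set.uIcc_of_le ht]
  exact Set.Icc_subset_Ici_self

theorem rlIntegral_sub {β t : ℝ} (hβ : 0 < β) {g h : ℝ → ℝ} (ht : 0 ≤ t)
    (hg : ContinuousOn g (Set.Ici 0)) (hh : ContinuousOn h (Set.Ici 0)) :
    rlIntegral β (fun s => g s - h s) t = rlIntegral β g t - rlIntegral β h t := by
  simp only [rlIntegral, mul_sub]
  rw [intervalIntegral.integral_sub (intervalIntegrable_sub_rpow_mul hβ ht hg)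
    (intervalIntegrable_sub_rpow_mul hβ ht hh), mul_sub]

theorem rlIntegral_const_mul (β c : ℝ) (g : ℝ → ℝ) (t : ℝ) :
    rlIntegral β (fun s => c * g s) t = c * rlIntegral β g t := by
  simp only [rlIntegral]
  rw [mul_left_comm, ← intervalIntegral.integral_const_mul (r := c)]
  simp only [mul_left_comm]

theorem rlIntegral_sum {ι : Type*} {β t : ℝ} (hβ : 0 < β) (S : Finset ι) {g : ι → ℝ → ℝ}
    (ht : 0 ≤ t) (hg : ∀ i ∈ S, ContinuousOn (g i) (Set.Ici 0)) :
    rlIntegral β (fun s => ∑ i ∈ S, g i s) t = ∑ i ∈ S, rlIntegral β (g i) t := by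
  unfold rlIntegral
  have h : (fun s => (t - s) ^ (β - 1) * ∑ i ∈ S, g i s) =
      fun s => ∑ i ∈ S, (t - s) ^ (β - 1) * g i s := funext fun s => Finset.mul_sum _ _ _
  rw [h, intervalIntegral.integral_finsetSum fun i hi =>
    intervalIntegrable_sub_rpow_mul hβ ht (hg i hi), Finset.mul_sum]

theorem abs_rlIntegral_le {β t : ℝ} (hβ : 0 < β) {g h : ℝ → ℝ} (ht : 0 ≤ t)
    (hh : ContinuousOn h (Set.Ici 0)) (hgh : ∀ s, 0 ≤ s → |g s| ≤ h s) :
    |rlIntegral β g t| ≤ rlIntegral β h t := by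
  have hG := Real.Gamma_pos_of_pos hβ
  rw [rlIntegral, rlIntegral, abs_mul, abs_of_pos (by positivity : 0 < 1 / Real.Gamma β)]
  refine mul_le_mul_of_nonneg_left ?_ (by positivity)
  rw [← Real.norm_eq_abs]
  refine intervalIntegral.norm_integral_le_of_norm_le ht
    (Filter.Eventually.of_forall fun s hs => ?_) (intervalIntegrable_sub_rpow_mul hβ ht hh)
  rw [norm_mul, Real.norm_of_nonneg (Real.rpow_nonneg (by linarith [hs.2]) _), Real.norm_eq_abs]
  exact mul_le_mul_of_nonneg_left (hgh s hs.1.le) (Real.rpow_nonneg (by linarith [hs.2]) _)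

/-! ### Picard iteration -/

open PowerSeries in
/-- Picard iteration for a triangular system of Volterra equations of convolution type. -/
theorem abs_sub_sum_coeff_pow_mul_rlPow_le {β K : ℝ} (hβ : 0 < β) (A : PowerSeries ℝ)
    (hA : ∀ n, ∑ p ∈ Finset.HasAntidiagonal.antidiagonal n, |coeff p.1 A| ≤ K) {f : ℕ → ℝ → ℝ}
    (hf : ∀ n, ContinuousOn (f n) (Set.Ici 0)) (hf1 : ∀ n t, 0 ≤ t → |f n t| ≤ 1)
    (hvol : ∀ n t, 0 ≤ t → f n t = (if n = 0 then 1 else 0) +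
      rlIntegral β (fun s => ∑ p ∈ Finset.HasAntidiagonal.antidiagonal n, coeff p.1 A * f p.2 s) t)
    (N n : ℕ) {t : ℝ} (ht : 0 ≤ t) :
    |f n t - ∑ m ∈ Finset.range N, coeff n (A ^ m) * rlPow β m t| ≤ K ^ N * rlPow β N t := by
  induction N generalizing n t with
  | zero => simpa [rlPow_zero] using hf1 n t ht
  | succ N ih =>
    set r : ℕ → ℝ → ℝ := fun n s =>
      f n s - ∑ m ∈ Finset.range N, coeff n (A ^ m) * rlPow β m s with hr
    -- Convolving A with the coefficients of A^m gives those of A^(m+1), and J raises the power of t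
    -- in step; the new term m = 0 cancels the initial value.
    have key : f n t - ∑ m ∈ Finset.range (N + 1), coeff n (A ^ m) * rlPow β m t =
        rlIntegral β (fun s => ∑ p ∈ Finset.HasAntidiagonal.antidiagonal n, coeff p.1 A * r p.2 s) t := by
      have h1 : (fun s => ∑ p ∈ Finset.HasAntidiagonal.antidiagonal n, coeff p.1 A * r p.2 s) = fun s =>
          ∑ p ∈ Finset.HasAntidiagonal.antidiagonal n, coeff p.1 A * f p.2 s -
            ∑ m ∈ Finset.range N, coeff n (A ^ (m + 1)) * rlPow β m s := by
        funext s
        simp only [hr, mul_sub, Finset.sum_sub_distrib, Finset.mul_sum]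
        congr 1
        rw [Finset.sum_comm]
        refine Finset.sum_congr rfl fun m _ => ?_
        rw [pow_succ', coeff_mul, Finset.sum_mul]
        exact Finset.sum_congr rfl fun p _ => (mul_assoc _ _ _).symm
      have h2 := rlIntegral_sum hβ (Finset.range N)
        (g := fun m s => coeff n (A ^ (m + 1)) * rlPow β m s) ht
        fun m _ => continuousOn_const.mul (continuousOn_rlPow hβ m _)
      simp only [rlIntegral_const_mul, rlIntegral_rlPow hβ ht] at h2
      rw [h1, rlIntegral_sub hβ ht, h2, hvol n t ht, Finset.sum_range_succ', rlPow_zero, pow_zero,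
        coeff_one]
      · ring
      · exact continuousOn_finsetSum _ fun p _ => continuousOn_const.mul (hf p.2)
      · exact continuousOn_finsetSum _ fun m _ => continuousOn_const.mul (continuousOn_rlPow hβ m _)
    -- The bound for N + 1 is itself J applied to K times the bound for N, so it suffices to compare
    -- integrands.
    rw [key, pow_succ', mul_assoc, ← rlIntegral_rlPow hβ ht, ← rlIntegral_const_mul,
      ← rlIntegral_const_mul]
    refine abs_rlIntegral_le hβ ht
      (continuousOn_const.mul (continuousOn_const.mul (continuousOn_rlPow hβ N _))) fun s hs => ?_
    have hnn : 0 ≤ K ^ N * rlPow β N s := (abs_nonneg _).trans (ih n hs)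
    calc |∑ p ∈ Finset.HasAntidiagonal.antidiagonal n, coeff p.1 A * r p.2 s|
        ≤ ∑ p ∈ Finset.HasAntidiagonal.antidiagonal n, |coeff p.1 A * r p.2 s| := Finset.abs_sum_le_sum_abs _ _
      _ ≤ ∑ p ∈ Finset.HasAntidiagonal.antidiagonal n, |coeff p.1 A| * (K ^ N * rlPow β N s) := by
          refine Finset.sum_le_sum fun p _ => ?_
          rw [abs_mul]
          exact mul_le_mul_of_nonneg_left (ih p.2 hs) (abs_nonneg _)
      _ = (∑ p ∈ Finset.HasAntidiagonal.antidiagonal n, |coeff p.1 A|) * (K ^ N * rlPow β N s) := by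
          rw [Finset.sum_mul]
      _ ≤ K * (K ^ N * rlPow β N s) := mul_le_mul_of_nonneg_right (hA n) hnn

open PowerSeries Filter Topology in
theorem tendsto_sum_coeff_pow_mul_rlPow {β K : ℝ} (hβ : 0 < β) (A : PowerSeries ℝ)
    (hA : ∀ n, ∑ p ∈ Finset.HasAntidiagonal.antidiagonal n, |coeff p.1 A| ≤ K) {f : ℕ → ℝ → ℝ}
    (hf : ∀ n, ContinuousOn (f n) (Set.Ici 0)) (hf1 : ∀ n t, 0 ≤ t → |f n t| ≤ 1)
    (hvol : ∀ n t, 0 ≤ t → f n t = (if n = 0 then 1 else 0) +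
      rlIntegral β (fun s => ∑ p ∈ Finset.HasAntidiagonal.antidiagonal n, coeff p.1 A * f p.2 s) t)
    (n : ℕ) {t : ℝ} (ht : 0 ≤ t) :
    Tendsto (fun N => ∑ m ∈ Finset.range N, coeff n (A ^ m) * rlPow β m t) atTop (𝓝 (f n t)) := by
  have hK : 0 ≤ K := (Finset.sum_nonneg fun _ _ => abs_nonneg _).trans (hA 0)
  rw [tendsto_iff_norm_sub_tendsto_zero]
  refine squeeze_zero (fun _ => norm_nonneg _) (fun N => ?_)
    (summable_pow_mul_rlPow hβ ht hK).tendsto_atTop_zero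
  rw [norm_sub_rev, Real.norm_eq_abs]
  exact abs_sub_sum_coeff_pow_mul_rlPow_le hβ A hA hf hf1 hvol N n ht

/-! ### Coefficients of powers as sums over Ω_n -/

/-- The weight `z! ∏ a_j ^ x_j / x_j!` of a tuple `x` with `z = ∑ x_j`. -/
noncomputable def tupleWeight (a : ℕ → ℝ) {n : ℕ} (x : Fin n → ℕ) : ℝ :=
  (∏ i : Fin n, a (i + 1) ^ x i / ((x i)! : ℝ)) * ((∑ i, x i)! : ℝ)

theorem multinomial_mul_prod_eq_tupleWeight (a : ℕ → ℝ) {n : ℕ} (x : Fin n → ℕ) :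
    (Nat.multinomial Finset.univ x : ℝ) * ∏ i : Fin n, a (i + 1) ^ x i = tupleWeight a x := by
  have h := Nat.multinomial_spec Finset.univ x
  have h' : ((∏ i, (x i)! : ℕ) : ℝ) * (Nat.multinomial Finset.univ x : ℝ) =
      ((∑ i, x i)! : ℝ) := by exact_mod_cast h
  have hne : (∏ i, ((x i)! : ℝ)) ≠ 0 :=
    Finset.prod_ne_zero_iff.2 fun i _ => by exact_mod_cast (x i).factorial_ne_zero
  rw [tupleWeight, Finset.prod_div_distrib, ← h']
  push_cast
  field_simp

-- Terms of degree above n do not affect the coefficient of X^n, so the series may be replaced by a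
-- sum of n monomials. In its multinomial expansion the tuple x contributes degree ∑ j x_j, which
-- singles out Ω_n.
open PowerSeries in
theorem coeff_mk_pow (a : ℕ → ℝ) (n z : ℕ) :
    coeff n ((mk fun j => if j = 0 then 0 else a j) ^ z) =
      ∑ x ∈ partitionTuples n, if ∑ i, x i = z then tupleWeight a x else 0 := by
  set B : PowerSeries ℝ := mk fun j => if j = 0 then 0 else a j with hB
  have htr : ((trunc (n + 1) B : Polynomial ℝ) : PowerSeries ℝ) =
      ∑ i : Fin n, C (a (i + 1)) * X ^ ((i : ℕ) + 1) := by
    ext k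
    rw [Polynomial.coeff_coe, coeff_trunc, map_sum]
    simp only [coeff_C_mul, coeff_X_pow, mul_ite, mul_one, mul_zero, hB, coeff_mk]
    rcases k with _ | k
    · simp
    · rw [Fin.sum_univ_eq_sum_range (fun i => if k + 1 = i + 1 then a (i + 1) else 0) n]
      simp
  have h1 : coeff n (B ^ z) = coeff n ((∑ i : Fin n, C (a (i + 1)) * X ^ ((i : ℕ) + 1)) ^ z) := by
    rw [← htr, ← coeff_coe_trunc_of_lt (Nat.lt_succ_self n), ← trunc_trunc_pow,
      coeff_coe_trunc_of_lt (Nat.lt_succ_self n)]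
  rw [h1, Finset.sum_pow_eq_sum_piAntidiag, map_sum, ← Finset.sum_filter]
  have h2 : ∀ x : Fin n → ℕ, coeff n ((Nat.multinomial Finset.univ x : PowerSeries ℝ) *
      ∏ i : Fin n, (C (a (i + 1)) * X ^ ((i : ℕ) + 1)) ^ x i) =
      if ∑ i : Fin n, ((i : ℕ) + 1) * x i = n then tupleWeight a x else 0 := by
    intro x
    have : (Nat.multinomial Finset.univ x : PowerSeries ℝ) *
        ∏ i : Fin n, (C (a (i + 1)) * X ^ ((i : ℕ) + 1)) ^ x i =
        C (tupleWeight a x) * X ^ (∑ i : Fin n, ((i : ℕ) + 1) * x i) := by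
      rw [← multinomial_mul_prod_eq_tupleWeight, map_mul, map_natCast, map_prod,
        ← Finset.prod_pow_eq_pow_sum, mul_assoc, ← Finset.prod_mul_distrib]
      simp only [mul_pow, map_pow, pow_mul]
    rw [this, coeff_C_mul, coeff_X_pow, mul_ite, mul_one, mul_zero]
    simp only [eq_comm]
  simp only [h2]
  rw [← Finset.sum_filter]
  refine Finset.sum_congr ?_ fun _ _ => rfl
  ext x
  simp only [Finset.mem_filter, Finset.mem_piAntidiag, mem_partitionTuples, Finset.mem_univ,
    implies_true, and_true]
  exact and_comm

open PowerSeries in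
theorem coeff_mk_pow_eq_sum_tupleWeight (a : ℕ → ℝ) (l : ℝ) (n m : ℕ) :
    coeff n ((mk fun j => if j = 0 then l else a j) ^ m) =
      ∑ x ∈ partitionTuples n,
        tupleWeight a x * ((m.choose (∑ i, x i) : ℝ) * l ^ (m - ∑ i, x i)) := by
  have hA : (mk fun j => if j = 0 then l else a j) =
      (mk fun j => if j = 0 then 0 else a j) + C l := by
    ext k
    by_cases hk : k = 0 <;> simp [hk, coeff_C]
  rw [hA, add_pow, map_sum]
  have h1 : ∀ z, coeff n ((mk fun j => if j = 0 then 0 else a j) ^ z * C l ^ (m - z) *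
      (m.choose z : PowerSeries ℝ)) =
      ∑ x ∈ partitionTuples n, if ∑ i, x i = z then
        tupleWeight a x * ((m.choose z : ℝ) * l ^ (m - z)) else 0 := by
    intro z
    have : (mk fun j => if j = 0 then 0 else a j) ^ z * C l ^ (m - z) *
        (m.choose z : PowerSeries ℝ) =
        C (l ^ (m - z) * (m.choose z : ℝ)) * (mk fun j => if j = 0 then 0 else a j) ^ z := by
      rw [map_mul, map_pow, map_natCast]
      ring
    rw [this, coeff_C_mul, coeff_mk_pow, Finset.mul_sum]
    refine Finset.sum_congr rfl fun x _ => ?_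
    split_ifs <;> ring
  simp only [h1]
  rw [Finset.sum_comm]
  refine Finset.sum_congr rfl fun x _ => ?_
  rw [Finset.sum_ite_eq]
  split_ifs with h
  · rfl
  -- A tuple with z > m is absent from the binomial sum; its binomial coefficient is 0, so the
  -- truncated exponent m - z does no harm.
  · rw [Nat.choose_eq_zero_of_lt (by simpa using h)]
    simp

/-! ### Summation to Mittag-Leffler functions -/

/-- The terms with m < z vanish. Putting m = j + z, the binomial coefficient is Γ(j+z+1)/(j!
Γ(z+1)), and t^(zβ) factors out. -/
theorem hasSum_choose_mul_rlPow {β l t : ℝ} (hβ : 0 < β) (ht : 0 ≤ t) (z : ℕ) :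
    HasSum (fun m : ℕ => (m.choose z : ℝ) * l ^ (m - z) * rlPow β m t)
      (t ^ ((z : ℝ) * β) * mittagLeffler3 β (z * β + 1) (z + 1) (l * t ^ β)) := by
  have hs : Summable fun m : ℕ => (m.choose z : ℝ) * l ^ (m - z) * rlPow β m t := by
    refine Summable.of_norm_bounded
      (summable_pow_mul_rlPow (K := 2 * (1 + |l|)) hβ ht (by positivity)) fun m => ?_
    rw [norm_mul, Real.norm_of_nonneg (rlPow_nonneg hβ ht m)]
    refine mul_le_mul_of_nonneg_right ?_ (rlPow_nonneg hβ ht m)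
    rw [norm_mul, norm_pow, mul_pow, Real.norm_natCast, Real.norm_eq_abs]
    have h1 : (m.choose z : ℝ) ≤ 2 ^ m := by exact_mod_cast Nat.choose_le_two_pow m z
    have h2 : |l| ^ (m - z) ≤ (1 + |l|) ^ m :=
      (pow_le_pow_left₀ (abs_nonneg l) (by linarith) _).trans
        (pow_le_pow_right₀ (by linarith [abs_nonneg l]) (Nat.sub_le m z))
    gcongr
  have h := hs.hasSum
  rw [← hs.sum_add_tsum_nat_add z, Finset.sum_eq_zero, zero_add] at h
  · convert h using 1
    rw [mittagLeffler3, ← tsum_mul_left, ← tsum_mul_left]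
    refine tsum_congr fun j => ?_
    have e1 : Real.Gamma ((z : ℝ) + 1) = (z ! : ℝ) := Real.Gamma_nat_eq_factorial z
    have e2 : Real.Gamma ((j : ℝ) + (z + 1)) = ((j + z)! : ℝ) := by
      rw [← Real.Gamma_nat_eq_factorial]
      push_cast
      ring_nf
    have e3 : ((j + z).choose z : ℝ) = ((j + z)! : ℝ) / ((j ! : ℝ) * (z ! : ℝ)) := by
      rw [← Nat.choose_symm_add, Nat.cast_add_choose]
    have e4 : t ^ (((j + z : ℕ) : ℝ) * β) = t ^ ((z : ℝ) * β) * (t ^ β) ^ j := by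
      rw [← Real.rpow_natCast, ← Real.rpow_mul ht, ← Real.rpow_add_of_nonneg ht (by positivity)
        (by positivity)]
      push_cast
      ring_nf
    have e5 : (j : ℝ) * β + (z * β + 1) = ((j + z : ℕ) : ℝ) * β + 1 := by push_cast; ring
    rw [e1, e2, e3, rlPow, e4, e5, mul_pow, Nat.add_sub_cancel]
    field_simp
  · intro m hm
    rw [Nat.choose_eq_zero_of_lt (Finset.mem_range.1 hm)]
    simp

/-! ### The state probabilities -/

theorem sum_antidiagonal_eq_add_sum_Icc (G : ℕ → ℕ → ℝ) (n : ℕ) :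
    ∑ p ∈ Finset.HasAntidiagonal.antidiagonal n, G p.1 p.2 =
      G 0 n + ∑ j ∈ Finset.Icc 1 n, G j (n - j) := by
  rw [Finset.Nat.sum_antidiagonal_eq_sum_range_succ G n, Finset.range_eq_Ico,
    Finset.sum_eq_sum_Ico_succ_bot (Nat.succ_pos n)]
  rfl

theorem sum_Icc_pow_div_factorial_le {θ : ℝ} (hθ : 0 ≤ θ) (n : ℕ) :
    ∑ j ∈ Finset.Icc 1 n, θ ^ j / (j ! : ℝ) ≤ Real.exp θ - 1 := by
  have h := Real.sum_le_exp_of_nonneg hθ (n + 1)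
  rw [Finset.range_eq_Ico, Finset.sum_eq_sum_Ico_succ_bot (Nat.succ_pos n)] at h
  have h' : (1 : ℝ) + ∑ j ∈ Finset.Icc 1 n, θ ^ j / (j ! : ℝ) ≤ Real.exp θ := by
    convert h using 2
    · simp
    · rfl
  linarith

namespace IsFractionalBellTouchard

variable {Ω : Type*} [MeasurableSpace Ω] {P : Measure Ω} {α θ β : ℝ} {M : ℝ≥0 → Ω → ℕ}

theorem continuousOn_stateProb (hM : IsFractionalBellTouchard P α θ β M) (n : ℕ) :
    ContinuousOn (stateProb P M n) (Set.Ici 0) := by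
  intro t ht
  have ht' : (0 : ℝ) ≤ t := ht
  have h := (hM.absolutelyContinuous n (t + 1) (by linarith)).continuousOn
  rw [Set.uIcc_of_le (by linarith)] at h
  refine (h t ⟨ht', by linarith⟩).mono_of_mem_nhdsWithin ?_
  rw [mem_nhdsWithin]
  exact ⟨Set.Iio (t + 1), isOpen_Iio, by simp, fun s hs => ⟨hs.2, hs.1.le⟩⟩

theorem caputoDeriv_stateProb (hM : IsFractionalBellTouchard P α θ β M) (n : ℕ) :
    ∀ᵐ t : ℝ, 0 < t → caputoDeriv β (stateProb P M n) t =
      -α * (Real.exp θ - 1) * stateProb P M n t +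
        α * ∑ j ∈ Finset.Icc 1 n, θ ^ j / (j ! : ℝ) * stateProb P M (n - j) t := by
  rcases Nat.eq_zero_or_pos n with rfl | hn
  · simpa using hM.system_zero
  · exact hM.system_pos n hn

theorem stateProb_initial (hM : IsFractionalBellTouchard P α θ β M) (n : ℕ) :
    stateProb P M n 0 = if n = 0 then 1 else 0 := by
  split_ifs with h
  · rw [h, hM.initial_zero]
  · exact hM.initial_pos n (Nat.one_le_iff_ne_zero.2 h)

open PowerSeries in
theorem stateProb_eq_sum [IsProbabilityMeasure P] (hα : 0 < α) (hθ : 0 < θ) (hβ : 0 < β)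
    (hβ1 : β ≤ 1) (hM : IsFractionalBellTouchard P α θ β M) (n : ℕ) {t : ℝ} (ht : 0 ≤ t) :
    stateProb P M n t = ∑ x ∈ partitionTuples n,
      tupleWeight (fun j => α * θ ^ j / (j ! : ℝ)) x *
        (t ^ (((∑ i, x i : ℕ) : ℝ) * β) *
          mittagLeffler3 β (((∑ i, x i : ℕ) : ℝ) * β + 1) (((∑ i, x i : ℕ) : ℝ) + 1)
            (-α * (Real.exp θ - 1) * t ^ β)) := by
  set l : ℝ := -α * (Real.exp θ - 1) with hl
  set a : ℕ → ℝ := fun j => α * θ ^ j / (j ! : ℝ) with ha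
  set A : PowerSeries ℝ := PowerSeries.mk fun j => if j = 0 then l else a j with hAdef
  -- The exponential series bounds the coefficient sums uniformly in n, giving the constant K of the
  -- Picard bound.
  have hA : ∀ n, ∑ p ∈ Finset.HasAntidiagonal.antidiagonal n, |coeff p.1 A| ≤
      |l| + α * (Real.exp θ - 1) := by
    intro n
    rw [sum_antidiagonal_eq_add_sum_Icc (fun i _ => |coeff i A|) n]
    have h1 : ∑ j ∈ Finset.Icc 1 n, |coeff j A| =
        α * ∑ j ∈ Finset.Icc 1 n, θ ^ j / (j ! : ℝ) := by
      rw [Finset.mul_sum]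
      refine Finset.sum_congr rfl fun j hj => ?_
      have hj0 : j ≠ 0 := by have := (Finset.mem_Icc.1 hj).1; omega
      rw [hAdef, coeff_mk, if_neg hj0, ha]
      simp only
      rw [abs_of_nonneg (by positivity), mul_div_assoc]
    rw [h1]
    simp only [hAdef, coeff_mk, if_true]
    gcongr
    exact sum_Icc_pow_div_factorial_le hθ.le n
  have hvol : ∀ n t, 0 ≤ t → stateProb P M n t = (if n = 0 then 1 else 0) +
      rlIntegral β (fun s => ∑ p ∈ Finset.HasAntidiagonal.antidiagonal n,
        coeff p.1 A * stateProb P M p.2 s) t := by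
    intro n t ht
    -- Absolute continuity is given only on [0, T] with T > 0, so t = 0 is treated apart.
    rcases ht.eq_or_lt with rfl | htpos
    · simp [rlIntegral, hM.stateProb_initial]
    rw [← hM.stateProb_initial n]
    refine eq_add_integral_of_caputoDeriv_eq hβ hβ1 ht (hM.absolutelyContinuous n t htpos) ?_
    filter_upwards [hM.caputoDeriv_stateProb n] with s hs hs0
    rw [hs hs0, sum_antidiagonal_eq_add_sum_Icc (fun i j => coeff i A * stateProb P M j s) n,
      Finset.mul_sum]
    congr 1
    · simp [hAdef, hl]
    · refine Finset.sum_congr rfl fun j hj => ?_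
      have hj0 : j ≠ 0 := by have := (Finset.mem_Icc.1 hj).1; omega
      rw [hAdef, coeff_mk, if_neg hj0, ha]
      ring
  have hlim := tendsto_sum_coeff_pow_mul_rlPow hβ A hA (f := stateProb P M)
    hM.continuousOn_stateProb
    (fun n t _ => by
      rw [stateProb, abs_of_nonneg measureReal_nonneg]
      exact measureReal_le_one) hvol n ht
  have hsum : HasSum (fun m => coeff n (A ^ m) * rlPow β m t) (∑ x ∈ partitionTuples n,
      tupleWeight a x * (t ^ (((∑ i, x i : ℕ) : ℝ) * β) *
        mittagLeffler3 β (((∑ i, x i : ℕ) : ℝ) * β + 1) (((∑ i, x i : ℕ) : ℝ) + 1)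
          (l * t ^ β))) := by
    have h1 : (fun m => coeff n (A ^ m) * rlPow β m t) = fun m =>
        ∑ x ∈ partitionTuples n, tupleWeight a x *
          ((m.choose (∑ i, x i) : ℝ) * l ^ (m - ∑ i, x i) * rlPow β m t) := by
      funext m
      rw [hAdef, coeff_mk_pow_eq_sum_tupleWeight, Finset.sum_mul]
      exact Finset.sum_congr rfl fun x _ => mul_assoc _ _ _
    rw [h1]
    exact hasSum_sum fun x _ => (hasSum_choose_mul_rlPow hβ ht _).mul_left _
  exact tendsto_nhds_unique hlim hsum.tendsto_sum_nat

end IsFractionalBellTouchard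

theorem mainTheorem2 {Ω : Type*} [MeasurableSpace Ω] (P : Measure Ω) [IsProbabilityMeasure P]
    (α θ β : ℝ) (hα : 0 < α) (hθ : 0 < θ) (hβ : 0 < β) (hβ1 : β ≤ 1)
    (M : ℝ≥0 → Ω → ℕ) (hM : IsFractionalBellTouchard P α θ β M) (t : ℝ) (ht : 0 ≤ t) :
    stateProb P M 0 t = mittagLeffler2 β 1 (-α * (Real.exp θ - 1) * t ^ β) ∧
    ∀ n : ℕ, 1 ≤ n →
      stateProb P M n t =
        ∑ x ∈ partitionTuples n,
          (∏ i : Fin n,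
            (α * θ ^ ((i : ℕ) + 1) / (((i : ℕ) + 1)! : ℝ)) ^ (x i) / ((x i)! : ℝ)) *
          ((∑ i, x i)! : ℝ) * t ^ (((∑ i, x i : ℕ) : ℝ) * β) *
          mittagLeffler3 β (((∑ i, x i : ℕ) : ℝ) * β + 1) (((∑ i, x i : ℕ) : ℝ) + 1)
            (-α * (Real.exp θ - 1) * t ^ β) := by
  constructor
  -- For n = 0 the only tuple is the empty one, with z = 0 and weight 1.
  · have h0 : partitionTuples 0 = Finset.univ := by
      refine Finset.eq_univ_iff_forall.2 fun x => ?_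
      simp [mem_partitionTuples]
    rw [hM.stateProb_eq_sum hα hθ hβ hβ1 0 ht, h0]
    simp [tupleWeight, mittagLeffler2]
  · intro n _
    rw [hM.stateProb_eq_sum hα hθ hβ hβ1 n ht]
    refine Finset.sum_congr rfl fun x _ => ?_
    rw [tupleWeight]
    ring
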